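/- Theorem 3.2. An MV-algebra is an algebra $(M;\oplus,{}^*,0,1)$ of type $(2,1,0,0)$ such that for all $a,b,c\in M$: $a\oplus b=b\oplus a$; $(a\oplus b)\oplus c=a\oplus(b\oplus c)$; $a\oplus 0=a$; $a\oplus 1=1$; $(a^*)^*=a$; $a\oplus a^*=1$; $0^*=1$; $(a^*\oplus b)^*\oplus b=(a\oplus b^*)^*\oplus a$. It is partially ordered by $a\le b$ if and only if $a^*\oplus b=1$. The partial sum $a+b$ is defined if and only if $a\le b^*$, and then $a+b:=a\oplus b$. A $\sigma$-MV-algebra is an MV-algebra in which every sequence has a supremum (equivalently, every sequence has an infimum). Let $\mathcal B(\mathbb R)$ be the Borel $\sigma$-algebra of $\mathbb R$. An observable on a $\sigma$-MV-algebra $M$ is a map $x:\mathcal B(\mathbb R)\to M$ such that (i) $x(\mathbb R)=1$; (ii) if $E,F\in\mathcal B(\mathbb R)$ are disjoint, then $x(E)+x(F)$ is defined and $x(E\cup F)=x(E)+x(F)$; (iii) if $E_1\subseteq E_2\subseteq\cdots$ are Borel sets and $E=\bigcup_i E_i$, then $x(E)=\bigvee_i x(E_i)$. Let $M$ be a $\sigma$-MV-algebra.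 (a) Let $x$ be an observable on $M$, and put $x_t:=x((-\infty,t))$ for $t\in\mathbb R$. Then $$x_t\le x_s\ \text{ if } t<s;\qquad \bigwedge_{t\in\mathbb R}x_t=0,\quad \bigvee_{t\in\mathbb R}x_t=1;\qquad \bigvee_{t<s}x_t=x_s\ \text{ for every } s\in\mathbb R,$$ where the existence of these suprema and of the infimum in $M$ is part of the assertion. (b) Conversely, if $\{x_t:t\in\mathbb R\}$ is a family of elements of $M$ for which these suprema and this infimum exist and all the properties displayed in (a) hold, then there is a unique observable $x$ on $M$ such that $x((-\infty,t))=x_t$ for all $t\in\mathbb R$. -/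

import Mathlib

/-- An MV-algebra `(M; ⊕, *, 0, 1)`, by Chang's axioms. -/
class MVAlgebra (M : Type*) extends Zero M, One M where
  /-- the total addition `a ⊕ b` -/
  oplus : M → M → M
  /-- the complement `a*` -/
  compl : M → M
  oplus_comm : ∀ a b : M, oplus a b = oplus b a
  oplus_assoc : ∀ a b c : M, oplus (oplus a b) c = oplus a (oplus b c)
  oplus_zero : ∀ a : M, oplus a 0 = a
  oplus_one : ∀ a : M, oplus a 1 = 1
  compl_compl : ∀ a : M, compl (compl a) = a
  oplus_compl : ∀ a : M, oplus a (compl a) = 1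
  compl_zero : compl 0 = 1
  lukasiewicz : ∀ a b : M,
    oplus (compl (oplus (compl a) b)) b = oplus (compl (oplus a (compl b))) a

namespace MVAlgebra

variable {M : Type*} [MVAlgebra M]

theorem compl_one : compl (1 : M) = 0 := by
  rw [← compl_zero, compl_compl]

theorem zero_oplus (a : M) : oplus 0 a = a := by
  rw [oplus_comm, oplus_zero]

theorem one_oplus (a : M) : oplus 1 a = 1 := by
  rw [oplus_comm, oplus_one]

/-- The natural order of an MV-algebra: `a ≤ b` if and only if `a* ⊕ b = 1`
(equivalently, `a ⊕ c = b` for some `c`; see `le_iff_exists_oplus`). -/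
instance instPartialOrder : PartialOrder M where
  le a b := oplus (compl a) b = 1
  le_refl a := by rw [oplus_comm, oplus_compl]
  le_trans a b c hab hbc := by
    have h := lukasiewicz b c
    rw [hbc, compl_one, zero_oplus, oplus_comm] at h
    rw [h, ← oplus_assoc, hab, one_oplus]
  le_antisymm a b hab hba := by
    have h := lukasiewicz a b
    rw [hab, oplus_comm a, hba, compl_one, zero_oplus, zero_oplus] at h
    exact h.symm

theorem le_def (a b : M) : a ≤ b ↔ oplus (compl a) b = 1 := Iff.rfl

theorem le_iff_exists_oplus (a b : M) : a ≤ b ↔ ∃ c, oplus a c = b := by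
  constructor
  · intro hab
    have h := lukasiewicz a b
    rw [(le_def a b).1 hab, compl_one, zero_oplus, oplus_comm _ a] at h
    exact ⟨_, h.symm⟩
  · rintro ⟨c, rfl⟩
    rw [le_def, ← oplus_assoc, oplus_comm (compl a), oplus_compl, one_oplus]

/-- `IsPartialSum a b c` says that the partial sum `a + b` is defined, that is `a ≤ b*`,
and that its value `a ⊕ b` is `c`. -/
def IsPartialSum (a b c : M) : Prop :=
  a ≤ compl b ∧ oplus a b = c

end MVAlgebra

/-- A `σ`-MV-algebra: an MV-algebra in which every sequence has a supremum with respect to the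
natural order. As `*` is an order-reversing involution, every sequence then has an infimum too. -/
class SigmaMVAlgebra (M : Type*) extends MVAlgebra M where
  exists_isLUB : ∀ a : ℕ → M, ∃ s : M, IsLUB (Set.range a) s

/-- The Borel `σ`-algebra of the real line, as the type of Borel sets. -/
abbrev BorelSet : Type := {E : Set ℝ // MeasurableSet E}

/-- The Borel set `(-∞, t)`. -/
def BorelSet.Iio (t : ℝ) : BorelSet := ⟨Set.Iio t, measurableSet_Iio⟩

/-- An observable on `M`: a map `x` from the Borel sets of `ℝ` to `M` with `x(ℝ) = 1`, which turns
disjoint unions into partial sums and unions of increasing sequences into suprema. -/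
structure IsObservable {M : Type*} [SigmaMVAlgebra M] (x : BorelSet → M) : Prop where
  map_univ : x ⟨Set.univ, MeasurableSet.univ⟩ = 1
  map_union : ∀ (E F : Set ℝ) (hE : MeasurableSet E) (hF : MeasurableSet F), Disjoint E F →
    MVAlgebra.IsPartialSum (x ⟨E, hE⟩) (x ⟨F, hF⟩) (x ⟨E ∪ F, hE.union hF⟩)
  map_iUnion : ∀ (E : ℕ → Set ℝ) (hE : ∀ i, MeasurableSet (E i)), (∀ i, E i ⊆ E (i + 1)) →
    IsLUB (Set.range fun i => x ⟨E i, hE i⟩) (x ⟨⋃ i, E i, MeasurableSet.iUnion hE⟩)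

/-- The properties that characterize the families `x_t = x((-∞, t))`, for an `M`-valued family
indexed by `t ∈ ℝ`: it is nondecreasing, its infimum (exists and) is `0`, its supremum is `1`, and
for every real `s` the supremum of the `x_t` with `t < s` is `x_s`. -/
structure IsDistributionFamily {M : Type*} [SigmaMVAlgebra M] (f : ℝ → M) : Prop where
  mono : ∀ t s : ℝ, t < s → f t ≤ f s
  isGLB_zero : IsGLB (Set.range f) 0
  isLUB_one : IsLUB (Set.range f) 1
  left_cont : ∀ s : ℝ, IsLUB (f '' Set.Iio s) (f s)

/-! Part (a) follows from monotonicity of an observable and its continuity along increasing unions.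
Uniqueness is an induction over Borel sets starting from the half-lines `(-∞, t)`.

Existence is an argument of Loomis–Sikorski type. Countable completeness excludes infinitesimals, so
every nonzero element lies outside some ideal with archimedean totally ordered quotient. A
Hölder-type counting argument maps such a quotient to `[0, 1]`, so the unit homomorphisms `φ`
separate points (`exists_isUnitHom_pos`). They form a compact Hausdorff space in which cozero sets
of elements of `M` are a base. Hence a countable monotone supremum in `M` is a pointwise limit
outside a meagre set (`residual_tendsto_of_isLUB`).

For residually many `φ`, the map `t ↦ φ (f t)` thus tends to 0 and 1 at the two ends and determines
a probability measure. Each Borel set `E` has an `a : M` with `φ a` equal to the measure of `E` for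
residually many `φ` (`exists_value`). By Baire's theorem residual sets are dense, so `a` is unique
and the axioms of an observable pass from the measures to `M`. -/

namespace MVAlgebra

local infixl:65 " ⊕ₘ " => oplus

/-- The truncated difference `a ⊖ b = (a* ⊕ b)*`. -/
def ominus {M : Type*} [MVAlgebra M] (a b : M) : M := compl (oplus (compl a) b)

local infixl:65 " ⊖ₘ " => ominus

/-! ### Arithmetic of truncated differences and multiples -/

section Arithmetic

variable {M : Type*} [MVAlgebra M]

/-- The `n`-fold total sum `a ⊕ ⋯ ⊕ a`. -/
def nmul : ℕ → M → M
  | 0, _ => 0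
  | n + 1, a => nmul n a ⊕ₘ a

theorem zero_le (a : M) : 0 ≤ a := by
  rw [le_def, compl_zero, one_oplus]

theorem le_one (a : M) : a ≤ 1 := by
  rw [le_def, oplus_one]

theorem le_zero_iff {a : M} : a ≤ 0 ↔ a = 0 :=
  ⟨fun h => le_antisymm h (zero_le a), fun h => h.le⟩

theorem le_oplus_left (a b : M) : a ≤ a ⊕ₘ b := (le_iff_exists_oplus _ _).2 ⟨b, rfl⟩

theorem le_oplus_right (a b : M) : b ≤ a ⊕ₘ b := by
  rw [oplus_comm]; exact le_oplus_left b a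

theorem oplus_le_oplus_right {a b : M} (h : a ≤ b) (c : M) : a ⊕ₘ c ≤ b ⊕ₘ c := by
  obtain ⟨d, rfl⟩ := (le_iff_exists_oplus _ _).1 h
  rw [oplus_assoc, oplus_comm d, ← oplus_assoc]
  exact le_oplus_left _ _

theorem oplus_le_oplus {a b c d : M} (h : a ≤ b) (h' : c ≤ d) : a ⊕ₘ c ≤ b ⊕ₘ d :=
  (oplus_le_oplus_right h c).trans (by
    rw [oplus_comm b, oplus_comm b]; exact oplus_le_oplus_right h' b)

theorem compl_le_compl {a b : M} (h : a ≤ b) : compl b ≤ compl a := by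
  rw [le_def, compl_compl, oplus_comm]; exact h

theorem ominus_le_iff {a b c : M} : a ⊖ₘ b ≤ c ↔ a ≤ b ⊕ₘ c := by
  rw [le_def, le_def, ominus, compl_compl, oplus_assoc]

theorem ominus_ominus (a b c : M) : a ⊖ₘ b ⊖ₘ c = a ⊖ₘ (b ⊕ₘ c) := by
  simp only [ominus, compl_compl, oplus_assoc]

theorem ominus_eq_zero_iff {a b : M} : a ⊖ₘ b = 0 ↔ a ≤ b := by
  rw [← le_zero_iff, ominus_le_iff, oplus_zero]

theorem ominus_le (a b : M) : a ⊖ₘ b ≤ a := ominus_le_iff.2 (le_oplus_right _ _)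

theorem le_oplus_ominus (a b : M) : a ≤ b ⊕ₘ (a ⊖ₘ b) := ominus_le_iff.1 le_rfl

theorem ominus_le_ominus_right {a b : M} (h : a ≤ b) (c : M) : a ⊖ₘ c ≤ b ⊖ₘ c :=
  ominus_le_iff.2 (h.trans (le_oplus_ominus _ _))

theorem compl_ominus_compl (a b : M) : compl b ⊖ₘ compl a = a ⊖ₘ b := by
  rw [ominus, ominus, compl_compl, oplus_comm]

theorem one_ominus (a : M) : 1 ⊖ₘ a = compl a := by
  rw [ominus, compl_one, zero_oplus]

theorem ominus_oplus_comm (a b : M) : (a ⊖ₘ b) ⊕ₘ b = (b ⊖ₘ a) ⊕ₘ a := by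
  rw [ominus, ominus, lukasiewicz, oplus_comm a]

theorem ominus_oplus_of_le {a b : M} (h : b ≤ a) : (a ⊖ₘ b) ⊕ₘ b = a := by
  rw [ominus_oplus_comm, ominus_eq_zero_iff.2 h, zero_oplus]

/-- Both sides are the infimum of `a` and `b*`. -/
theorem oplus_ominus (a b : M) : (a ⊕ₘ b) ⊖ₘ b = a ⊖ₘ (a ⊖ₘ compl b) := by
  have h := lukasiewicz (compl a) b
  rw [compl_compl] at h
  simp only [ominus, h, oplus_comm]

theorem oplus_ominus_of_le {a b : M} (h : a ≤ compl b) : (a ⊕ₘ b) ⊖ₘ b = a := by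
  rw [oplus_ominus, ominus_eq_zero_iff.2 h, ominus, oplus_zero, compl_compl]

/-- `a ⊖ (a ⊖ b)` is the infimum of `a` and `b`. -/
theorem ominus_ominus_self_le (a b : M) : a ⊖ₘ (a ⊖ₘ b) ≤ b := by
  rw [ominus_le_iff, oplus_comm]; exact le_oplus_ominus a b

theorem le_ominus_ominus_self {a b c : M} (ha : c ≤ a) (hb : c ≤ b) : c ≤ a ⊖ₘ (a ⊖ₘ b) := by
  have h1 : a ⊖ₘ (a ⊖ₘ b) = compl ((compl b ⊖ₘ compl a) ⊕ₘ compl a) := by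
    rw [compl_ominus_compl, oplus_comm]; rfl
  rw [h1, ← compl_compl c]
  refine compl_le_compl ?_
  calc (compl b ⊖ₘ compl a) ⊕ₘ compl a ≤ (compl c ⊖ₘ compl a) ⊕ₘ compl a :=
        oplus_le_oplus_right (ominus_le_ominus_right (compl_le_compl hb) _) _
    _ = compl c := ominus_oplus_of_le (compl_le_compl ha)

theorem ominus_oplus_ominus_le (a b c : M) : a ⊖ₘ c ≤ (a ⊖ₘ b) ⊕ₘ (b ⊖ₘ c) := by
  rw [ominus_le_iff]
  calc a ≤ b ⊕ₘ (a ⊖ₘ b) := le_oplus_ominus _ _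
    _ ≤ (c ⊕ₘ (b ⊖ₘ c)) ⊕ₘ (a ⊖ₘ b) := oplus_le_oplus_right (le_oplus_ominus _ _) _
    _ = c ⊕ₘ ((a ⊖ₘ b) ⊕ₘ (b ⊖ₘ c)) := by rw [oplus_assoc, oplus_comm (b ⊖ₘ c)]

/-- The two truncated differences of a pair of elements are disjoint. -/
theorem eq_zero_of_le_ominus_of_le_ominus {a b z : M} (h1 : z ≤ a ⊖ₘ b) (h2 : z ≤ b ⊖ₘ a) :
    z = 0 := by
  -- With `m` the infimum of `a` and `b`, the sum `z ⊕ m` is below both, hence below `m`. Since `z ≤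
  -- m*`, cancelling `m` leaves `z ≤ 0`.
  set m := a ⊖ₘ (a ⊖ₘ b) with hm
  have hma : m ≤ a := ominus_le _ _
  have hmb : m ≤ b := ominus_ominus_self_le _ _
  have ha : z ⊕ₘ m ≤ a := by
    have h : a ⊖ₘ b ≤ a ⊖ₘ m := by
      rw [ominus_le_iff]
      calc a ≤ (a ⊖ₘ m) ⊕ₘ m := (ominus_oplus_of_le hma).ge
        _ ≤ b ⊕ₘ (a ⊖ₘ m) := by rw [oplus_comm]; exact oplus_le_oplus_right hmb _
    calc z ⊕ₘ m ≤ (a ⊖ₘ m) ⊕ₘ m := oplus_le_oplus_right (h1.trans h) _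
      _ = a := ominus_oplus_of_le hma
  have hb : z ⊕ₘ m ≤ b := by
    have h : b ⊖ₘ a ≤ b ⊖ₘ m := by
      rw [ominus_le_iff]
      calc b ≤ (b ⊖ₘ m) ⊕ₘ m := (ominus_oplus_of_le hmb).ge
        _ ≤ a ⊕ₘ (b ⊖ₘ m) := by rw [oplus_comm]; exact oplus_le_oplus_right hma _
    calc z ⊕ₘ m ≤ (b ⊖ₘ m) ⊕ₘ m := oplus_le_oplus_right (h2.trans h) _
      _ = b := ominus_oplus_of_le hmb
  have hz : z ≤ compl m := by
    rw [hm, ominus.eq_1 a, compl_compl]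
    exact h1.trans (le_oplus_right _ _)
  rw [← le_zero_iff, ← oplus_ominus_of_le hz, ominus_le_iff, oplus_zero]
  exact le_ominus_ominus_self ha hb

/-- The remainder of `z` after subtracting `n` copies of `y` lies below both `x` and `y`, so it
vanishes and one copy can be dropped. -/
theorem eq_zero_of_le_nmul {x y : M} (hxy : ∀ z : M, z ≤ x → z ≤ y → z = 0) (n : ℕ) :
    ∀ z : M, z ≤ x → z ≤ nmul n y → z = 0 := by
  induction n with
  | zero => exact fun z _ h => le_zero_iff.1 h
  | succ n ih =>
    intro z hx hy
    have h0 : z ⊖ₘ nmul n y = 0 := hxy _ ((ominus_le _ _).trans hx) (ominus_le_iff.2 hy)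
    exact ih z hx (ominus_eq_zero_iff.1 h0)

theorem nmul_add (m n : ℕ) (a : M) : nmul (m + n) a = nmul m a ⊕ₘ nmul n a := by
  induction n with
  | zero => exact (oplus_zero _).symm
  | succ n ih =>
    change nmul (m + n) a ⊕ₘ a = _ ⊕ₘ (nmul n a ⊕ₘ a)
    rw [ih, oplus_assoc]

theorem nmul_le_nmul_left {m n : ℕ} (h : m ≤ n) (a : M) : nmul m a ≤ nmul n a := by
  obtain ⟨k, rfl⟩ := Nat.exists_eq_add_of_le h
  rw [nmul_add]; exact le_oplus_left _ _

theorem nmul_one (a : M) : nmul 1 a = a := zero_oplus a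

theorem nmul_le_nmul_right (n : ℕ) {a b : M} (h : a ≤ b) : nmul n a ≤ nmul n b := by
  induction n with
  | zero => exact le_rfl
  | succ n ih => exact oplus_le_oplus ih h

theorem nmul_oplus (n : ℕ) (a b : M) : nmul n (a ⊕ₘ b) = nmul n a ⊕ₘ nmul n b := by
  induction n with
  | zero => exact (oplus_zero _).symm
  | succ n ih =>
    simp only [nmul, ih]
    rw [oplus_assoc, oplus_assoc, ← oplus_assoc (nmul n b), oplus_comm (nmul n b) a, oplus_assoc]

/-! ### Ideals, maximality and primeness -/

/-- Ideals of an MV-algebra. -/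
structure IsIdeal (I : Set M) : Prop where
  zero_mem : 0 ∈ I
  oplus_mem : ∀ a ∈ I, ∀ b ∈ I, a ⊕ₘ b ∈ I
  mem_of_le : ∀ a ∈ I, ∀ b ≤ a, b ∈ I

theorem isIdeal_zero : IsIdeal ({0} : Set M) where
  zero_mem := rfl
  oplus_mem := by rintro a rfl b rfl; exact oplus_zero 0
  mem_of_le := by rintro a rfl b h; exact le_zero_iff.1 h

theorem IsIdeal.nmul_mem {I : Set M} (hI : IsIdeal I) {a : M} (ha : a ∈ I) (n : ℕ) :
    nmul n a ∈ I := by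
  induction n with
  | zero => exact hI.zero_mem
  | succ n ih => exact hI.oplus_mem _ ih _ ha

/-- The ideal generated by an ideal `I` and an element `x`. -/
theorem IsIdeal.adjoin {I : Set M} (hI : IsIdeal I) (x : M) :
    IsIdeal {a : M | ∃ i ∈ I, ∃ n, a ≤ i ⊕ₘ nmul n x} where
  zero_mem := ⟨0, hI.zero_mem, 0, zero_le _⟩
  oplus_mem := by
    rintro a ⟨i, hi, n, ha⟩ b ⟨j, hj, m, hb⟩
    refine ⟨i ⊕ₘ j, hI.oplus_mem _ hi _ hj, n + m, (oplus_le_oplus ha hb).trans_eq ?_⟩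
    rw [nmul_add, oplus_assoc, oplus_assoc, ← oplus_assoc (nmul n x), oplus_comm (nmul n x) j,
      oplus_assoc]
  mem_of_le := fun a ⟨i, hi, n, ha⟩ b hb => ⟨i, hi, n, hb.trans ha⟩

/-- Every ideal avoiding `c` lies in one that is maximal with this property. -/
theorem IsIdeal.exists_maximal {J : Set M} (hJ : IsIdeal J) {c : M} (hc : c ∉ J) :
    ∃ I : Set M, J ⊆ I ∧ IsIdeal I ∧ c ∉ I ∧ ∀ x ∉ I, ∃ i ∈ I, ∃ n, c ≤ i ⊕ₘ nmul n x := by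
  obtain ⟨I, hJI, hI⟩ := zorn_subset_nonempty {I : Set M | IsIdeal I ∧ c ∉ I} (by
    intro S hS hchain hne
    refine ⟨⋃₀ S, ⟨⟨?_, ?_, ?_⟩, ?_⟩, fun s hs => Set.subset_sUnion_of_mem hs⟩
    · obtain ⟨s, hs⟩ := hne
      exact ⟨s, hs, (hS hs).1.zero_mem⟩
    · rintro a ⟨s, hs, ha⟩ b ⟨t, ht, hb⟩
      rcases hchain.total hs ht with h | h
      · exact ⟨t, ht, (hS ht).1.oplus_mem _ (h ha) _ hb⟩
      · exact ⟨s, hs, (hS hs).1.oplus_mem _ ha _ (h hb)⟩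
    · rintro a ⟨s, hs, ha⟩ b hb
      exact ⟨s, hs, (hS hs).1.mem_of_le _ ha _ hb⟩
    · rintro ⟨s, hs, h⟩
      exact (hS hs).2 h) J ⟨hJ, hc⟩
  refine ⟨I, hJI, hI.prop.1, hI.prop.2, fun x hx => ?_⟩
  by_contra hcon
  have hsub : I ⊆ {a : M | ∃ i ∈ I, ∃ n, a ≤ i ⊕ₘ nmul n x} :=
    fun i hi => ⟨i, hi, 0, le_oplus_left _ _⟩
  refine hx (hI.le_of_ge ⟨hI.prop.1.adjoin x, hcon⟩ hsub ⟨0, hI.prop.1.zero_mem, 1, ?_⟩)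
  rw [nmul_one]; exact le_oplus_right _ _

/-- An ideal is prime if it contains one of the two truncated differences of every pair. -/
def IsPrimeIdeal (I : Set M) : Prop := ∀ a b : M, a ⊖ₘ b ∈ I ∨ b ⊖ₘ a ∈ I

/-- If both differences were outside `I`, then, up to an element of `I`, `c` would lie below
multiples of both. These multiples are disjoint, which forces `c ∈ I`. -/
theorem IsIdeal.isPrimeIdeal_of_maximal {I : Set M} (hI : IsIdeal I) {c : M} (hc : c ∉ I)
    (hmax : ∀ x ∉ I, ∃ i ∈ I, ∃ n, c ≤ i ⊕ₘ nmul n x) : IsPrimeIdeal I := by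
  intro a b
  by_contra! hcon
  obtain ⟨i, hi, n, hn⟩ := hmax _ hcon.1
  obtain ⟨j, hj, m, hm⟩ := hmax _ hcon.2
  have h1 : c ⊖ₘ (i ⊕ₘ j) ≤ nmul n (a ⊖ₘ b) := by
    rw [ominus_le_iff]
    exact hn.trans (oplus_le_oplus_right (le_oplus_left _ _) _)
  have h2 : c ⊖ₘ (i ⊕ₘ j) ≤ nmul m (b ⊖ₘ a) := by
    rw [ominus_le_iff]
    exact hm.trans (oplus_le_oplus_right (le_oplus_right _ _) _)
  have h3 : c ⊖ₘ (i ⊕ₘ j) = 0 :=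
    eq_zero_of_le_nmul (fun z hz hz' =>
      eq_zero_of_le_nmul (fun w hw hw' => eq_zero_of_le_ominus_of_le_ominus hw' hw) n z hz' hz)
      m _ h1 h2
  exact hc (hI.mem_of_le _ (hI.oplus_mem _ hi _ hj) _ (ominus_eq_zero_iff.1 h3))

/-- An element which is not infinitesimal is avoided by a maximal ideal. -/
theorem exists_maximal_ideal {b : M} {n : ℕ} (h : ¬ nmul n b ≤ compl b) :
    ∃ I : Set M, IsIdeal I ∧ IsPrimeIdeal I ∧ 1 ∉ I ∧ b ∉ I ∧
      ∀ x ∉ I, ∃ n, 1 ⊖ₘ nmul n x ∈ I := by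
  -- A first ideal `P` avoids `nb ⊖ b*`; being prime, it contains `b* ⊖ nb`. A proper ideal
  -- containing `P` cannot contain `b`, since it would then contain `b*` and `b ⊕ b* = 1`.
  have hc : nmul n b ⊖ₘ compl b ∉ ({0} : Set M) := fun h0 => h (ominus_eq_zero_iff.1 h0)
  obtain ⟨P, -, hP, hcP, hPmax⟩ := isIdeal_zero.exists_maximal hc
  have hPp := hP.isPrimeIdeal_of_maximal hcP hPmax
  have h1P : (1 : M) ∉ P := fun h1 => hcP (hP.mem_of_le _ h1 _ (le_one _))
  obtain ⟨I, hPI, hI, h1I, hImax⟩ := hP.exists_maximal h1P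
  refine ⟨I, hI, hI.isPrimeIdeal_of_maximal h1I hImax, h1I, fun hb => h1I ?_, fun x hx => ?_⟩
  · have h2 : compl b ⊖ₘ nmul n b ∈ I := hPI ((hPp _ _).resolve_right hcP)
    have h3 : compl b ∈ I := hI.mem_of_le _
      (hI.oplus_mem _ (hI.nmul_mem hb n) _ h2) _ (le_oplus_ominus _ _)
    rw [← oplus_compl b]
    exact hI.oplus_mem _ hb _ h3
  · obtain ⟨i, hi, n, hn⟩ := hImax x hx
    refine ⟨n, hI.mem_of_le _ hi _ ?_⟩
    rw [ominus_le_iff, oplus_comm]; exact hn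

end Arithmetic

/-- A `σ`-MV-algebra has no nonzero infinitesimals. -/
theorem exists_not_nmul_le {M : Type*} [SigmaMVAlgebra M] {b : M} (hb : b ≠ 0) :
    ∃ n, ¬ nmul n b ≤ compl b := by
  by_contra! h
  obtain ⟨s, hs⟩ := SigmaMVAlgebra.exists_isLUB fun n => nmul n b
  have hle : ∀ n, nmul n b ≤ s := fun n => hs.1 ⟨n, rfl⟩
  -- Since `nb ≤ b*`, subtracting `b` from `(n+1)b` gives back `nb`. The supremum `s` therefore
  -- absorbs `b`, while `s ≤ b*` permits cancelling `s`.
  have h1 : s ≤ ominus s b := hs.2 (by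
    rintro _ ⟨n, rfl⟩
    change nmul n b ≤ _
    rw [← oplus_ominus_of_le (h n)]
    exact ominus_le_ominus_right (hle (n + 1)) b)
  have hbs : b ≤ s := by simpa only [nmul_one] using hle 1
  have h2 : s ≤ compl b := hs.2 (by rintro _ ⟨n, rfl⟩; exact h n)
  have h3 : oplus b s ≤ s := by
    rw [oplus_comm]
    exact (oplus_le_oplus_right h1 b).trans (ominus_oplus_of_le hbs).le
  have h4 : b ≤ compl s := by simpa only [compl_compl] using compl_le_compl h2
  apply hb
  rw [← le_zero_iff, ← oplus_ominus_of_le h4, ominus_le_iff, oplus_zero]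
  exact h3

/-- `φ` is a homomorphism into the standard MV-algebra on the real unit interval. -/
structure IsUnitHom {M : Type*} [MVAlgebra M] (φ : M → ℝ) : Prop where
  nonneg : ∀ a, 0 ≤ φ a
  map_zero : φ 0 = 0
  map_compl : ∀ a, φ (compl a) = 1 - φ a
  map_oplus : ∀ a b, φ (a ⊕ₘ b) = min 1 (φ a + φ b)

/-! ### Hölder's theorem for archimedean ideals -/

section Below

variable {M : Type*} [MVAlgebra M] {I : Set M}

/-- The preorder of an MV-algebra modulo an ideal. -/
def Below (I : Set M) (a b : M) : Prop := a ⊖ₘ b ∈ I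

theorem below_of_le (hI : IsIdeal I) {a b : M} (h : a ≤ b) : Below I a b := by
  rw [Below, ominus_eq_zero_iff.2 h]; exact hI.zero_mem

theorem Below.trans (hI : IsIdeal I) {a b c : M} (h : Below I a b) (h' : Below I b c) :
    Below I a c :=
  hI.mem_of_le _ (hI.oplus_mem _ h _ h') _ (ominus_oplus_ominus_le a b c)

theorem below_zero_iff {a : M} : Below I a 0 ↔ a ∈ I := by
  rw [Below, ominus, oplus_zero, compl_compl]

theorem Below.oplus_right (hI : IsIdeal I) {a b : M} (h : Below I a b) (c : M) :
    Below I (a ⊕ₘ c) (b ⊕ₘ c) := by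
  refine hI.mem_of_le _ h _ ?_
  rw [ominus_le_iff, oplus_assoc, oplus_comm c, ← oplus_assoc]
  exact oplus_le_oplus_right (le_oplus_ominus _ _) _

theorem Below.oplus (hI : IsIdeal I) {a b c d : M} (h : Below I a b) (h' : Below I c d) :
    Below I (a ⊕ₘ c) (b ⊕ₘ d) :=
  (h.oplus_right hI c).trans hI (by
    rw [oplus_comm b, oplus_comm b]; exact h'.oplus_right hI b)

theorem below_compl_comm {a b : M} : Below I a (compl b) ↔ Below I b (compl a) := by
  rw [Below, Below, ← compl_ominus_compl, compl_compl]

theorem ominus_below_iff {a b c : M} : Below I (a ⊖ₘ b) c ↔ Below I a (b ⊕ₘ c) := by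
  rw [Below, Below, ominus_ominus]

theorem below_oplus_ominus (hI : IsIdeal I) {a b : M} (h : Below I b (compl a)) :
    Below I b ((b ⊕ₘ a) ⊖ₘ a) := by
  rw [oplus_ominus, Below]
  exact hI.mem_of_le _ h _ (ominus_ominus_self_le _ _)

/-- Modulo `I`, a defined partial sum can be cancelled, hence is strictly monotone. This gives the
lower bounds on `count` of a sum. -/
theorem not_oplus_below (hI : IsIdeal I) {a b x y : M} (hx : Below I x a) (hy : ¬ Below I b y)
    (hab : Below I a (compl b)) : ¬ Below I (a ⊕ₘ b) (x ⊕ₘ y) := by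
  intro h
  refine hy ((below_oplus_ominus hI (below_compl_comm.1 hab)).trans hI ?_)
  rw [ominus_below_iff, oplus_comm]
  exact h.trans hI (hx.oplus_right hI y)

theorem ominus_oplus_below (hI : IsIdeal I) {a b : M} (h : Below I b a) :
    Below I ((a ⊖ₘ b) ⊕ₘ b) a := by
  have h0 : Below I (b ⊖ₘ a) 0 := below_zero_iff.2 h
  have h1 := h0.oplus_right hI a
  rwa [zero_oplus, ominus_oplus_comm] at h1

/-- The least number of copies of `ε` whose sum dominates `a` modulo the ideal. -/
noncomputable def count (I : Set M) (ε a : M) : ℕ := sInf {n | Below I a (nmul n ε)}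

/-- An ideal whose quotient is an archimedean totally ordered MV-algebra. -/
structure IsArchimedeanIdeal (I : Set M) : Prop extends IsIdeal I where
  isPrime : IsPrimeIdeal I
  one_notMem : 1 ∉ I
  exists_nmul : ∀ x ∉ I, ∃ n, Below I 1 (nmul n x)

theorem IsArchimedeanIdeal.below_of_not (hI : IsArchimedeanIdeal I) {a b : M}
    (h : ¬ Below I a b) : Below I b a := (hI.isPrime a b).resolve_left h

variable {ε : M}

theorem count_spec (hI : IsArchimedeanIdeal I) (hε : ε ∉ I) (a : M) :
    Below I a (nmul (count I ε a) ε) := by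
  obtain ⟨n, hn⟩ := hI.exists_nmul ε hε
  exact Nat.sInf_mem (s := {n | Below I a (nmul n ε)})
    ⟨n, (below_of_le hI.toIsIdeal (le_one a)).trans hI.toIsIdeal hn⟩

theorem not_below_of_lt_count {a : M} {n : ℕ} (h : n < count I ε a) : ¬ Below I a (nmul n ε) :=
  Nat.notMem_of_lt_sInf h

theorem count_le_of_below {a : M} {n : ℕ} (h : Below I a (nmul n ε)) : count I ε a ≤ n :=
  Nat.sInf_le h

theorem lt_count (hI : IsArchimedeanIdeal I) (hε : ε ∉ I) {a : M} {n : ℕ}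
    (h : ¬ Below I a (nmul n ε)) : n < count I ε a := by
  by_contra! hle
  exact h ((count_spec hI hε a).trans hI.toIsIdeal
    (below_of_le hI.toIsIdeal (nmul_le_nmul_left hle ε)))

theorem count_mono (hI : IsArchimedeanIdeal I) (hε : ε ∉ I) {a b : M} (h : Below I a b) :
    count I ε a ≤ count I ε b :=
  count_le_of_below (h.trans hI.toIsIdeal (count_spec hI hε b))

theorem count_oplus_le (hI : IsArchimedeanIdeal I) (hε : ε ∉ I) (a b : M) :
    count I ε (a ⊕ₘ b) ≤ count I ε a + count I ε b := by
  apply count_le_of_below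
  rw [nmul_add]
  exact (count_spec hI hε a).oplus hI.toIsIdeal (count_spec hI hε b)

/-- If the counts are `m, k > 0`, then `m - 1` and `k - 1` copies fall short of `a` and `b`, so `m +
k - 2` copies fall short of the sum. -/
theorem count_add_count_le (hI : IsArchimedeanIdeal I) (hε : ε ∉ I) {a b : M}
    (hab : Below I a (compl b)) :
    count I ε a + count I ε b ≤ count I ε (a ⊕ₘ b) + 1 := by
  have h1 := count_mono hI hε (below_of_le hI.toIsIdeal (le_oplus_left a b))
  have h2 := count_mono hI hε (below_of_le hI.toIsIdeal (le_oplus_right a b))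
  rcases Nat.eq_zero_or_pos (count I ε a) with ha | ha
  · omega
  rcases Nat.eq_zero_or_pos (count I ε b) with hb | hb
  · omega
  have h := not_oplus_below hI.toIsIdeal
    (hI.below_of_not (not_below_of_lt_count (Nat.sub_one_lt ha.ne')))
    (not_below_of_lt_count (Nat.sub_one_lt hb.ne')) hab
  rw [← nmul_add] at h
  have := lt_count hI hε h
  omega

/-- When `ε` is the least nonzero class, a nonzero remainder after `m` copies has room for one more.
Counts are then exact, with no rounding error. -/
theorem count_nmul_below_of_atom (hI : IsArchimedeanIdeal I) (hatom : ∀ x ∉ I, Below I ε x)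
    (a : M) : Below I (nmul (count I ε a) ε) a := by
  rcases h : count I ε a with _ | m
  · exact below_of_le hI.toIsIdeal (zero_le a)
  have hm : ¬ Below I a (nmul m ε) := not_below_of_lt_count (by omega)
  have h1 := (hatom _ hm).oplus_right hI.toIsIdeal (nmul m ε)
  rw [oplus_comm] at h1
  exact h1.trans hI.toIsIdeal (ominus_oplus_below hI.toIsIdeal (hI.below_of_not hm))

theorem count_add_count_le_of_atom (hI : IsArchimedeanIdeal I) (hε : ε ∉ I)
    (hatom : ∀ x ∉ I, Below I ε x) {a b : M} (hab : Below I a (compl b)) :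
    count I ε a + count I ε b ≤ count I ε (a ⊕ₘ b) := by
  rcases Nat.eq_zero_or_pos (count I ε b) with hb | hb
  · have h1 := count_mono hI hε (below_of_le hI.toIsIdeal (le_oplus_left a b))
    omega
  have h := not_oplus_below hI.toIsIdeal (count_nmul_below_of_atom hI hatom a)
    (not_below_of_lt_count (Nat.sub_one_lt hb.ne')) hab
  rw [← nmul_add] at h
  have := lt_count hI hε h
  omega

theorem exists_not_one_below_nmul (hI : IsArchimedeanIdeal I)
    (h : ∀ ε ∉ I, ∃ x ∉ I, ¬ Below I ε x) (j : ℕ) : ∃ ε ∉ I, ¬ Below I 1 (nmul (j + 1) ε) := by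
  induction j with
  | zero =>
    obtain ⟨x, hx, hx'⟩ := h 1 hI.one_notMem
    exact ⟨x, hx, by rwa [nmul_one]⟩
  | succ j ih =>
    obtain ⟨ε, hε, hj⟩ := ih
    obtain ⟨x, hx, hx'⟩ := h ε hε
    -- Halving: take the smaller of `x` and `ε ⊖ x`. Then `j + 2` copies of `δ` are at most `j + 1`
    -- copies of `ε`, as `j + 2 ≤ 2(j + 1)`.
    have key : ∃ δ ∉ I, Below I (δ ⊕ₘ δ) ε := by
      have hsum := ominus_oplus_below hI.toIsIdeal (hI.below_of_not hx')
      rcases hI.isPrime x (ε ⊖ₘ x) with h1 | h1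
      · exact ⟨x, hx, (Below.oplus_right hI.toIsIdeal h1 x).trans hI.toIsIdeal hsum⟩
      · refine ⟨ε ⊖ₘ x, hx', Below.trans hI.toIsIdeal ?_ hsum⟩
        rw [oplus_comm (ε ⊖ₘ x) x]
        exact Below.oplus_right hI.toIsIdeal h1 _
    obtain ⟨δ, hδ, hδε⟩ := key
    refine ⟨δ, hδ, fun hcon => hj ?_⟩
    have hmono : ∀ n, Below I (nmul n (δ ⊕ₘ δ)) (nmul n ε) := by
      intro n
      induction n with
      | zero => exact below_of_le hI.toIsIdeal le_rfl
      | succ n ih => exact ih.oplus hI.toIsIdeal hδε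
    refine (hcon.trans hI.toIsIdeal (below_of_le hI.toIsIdeal ?_)).trans hI.toIsIdeal
      (hmono (j + 1))
    rw [nmul_oplus, ← nmul_add]
    exact nmul_le_nmul_left (by omega) δ

/-- The count is additive up to an arbitrarily small relative error. -/
theorem exists_count_almost_additive (hI : IsArchimedeanIdeal I) (j : ℕ) :
    ∃ ε ∉ I, ∀ a b : M, Below I a (compl b) →
      (j + 1) * (count I ε a + count I ε b) ≤
        (j + 1) * count I ε (a ⊕ₘ b) + count I ε 1 := by
  -- Without a least nonzero class, `ε` can be so small that `count I ε 1` exceeds `j + 1`, which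
  -- absorbs the rounding error 1. With a least class there is no error.
  by_cases h : ∀ ε ∉ I, ∃ x ∉ I, ¬ Below I ε x
  · obtain ⟨ε, hε, h1⟩ := exists_not_one_below_nmul hI h j
    refine ⟨ε, hε, fun a b hab => ?_⟩
    have h2 := lt_count hI hε h1
    have h3 := Nat.mul_le_mul_left (j + 1) (count_add_count_le hI hε hab)
    rw [mul_add (j + 1) _ 1] at h3
    omega
  · push Not at h
    obtain ⟨ε, hε, hatom⟩ := h
    refine ⟨ε, hε, fun a b hab => ?_⟩
    have h3 := Nat.mul_le_mul_left (j + 1) (count_add_count_le_of_atom hI hε hatom hab)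
    omega

-- The normalised counts `count a / count 1` are additive up to `1 / (j + 1)`. A limit along a
-- nonprincipal ultrafilter exists for every `a` at once and is exactly additive.
open Filter Topology in
theorem exists_additive (hI : IsArchimedeanIdeal I) :
    ∃ φ : M → ℝ, (∀ a, 0 ≤ φ a) ∧ (∀ a b, Below I a b → φ a ≤ φ b) ∧ φ 1 = 1 ∧
      ∀ a b, Below I a (compl b) → φ (a ⊕ₘ b) = φ a + φ b := by
  choose ε hε hadd using exists_count_almost_additive hI
  set g : ℕ → M → ℝ := fun j a => (count I (ε j) a : ℝ) / count I (ε j) 1 with hg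
  have hpos : ∀ j, (0 : ℝ) < count I (ε j) 1 := fun j => by
    have : 0 < count I (ε j) 1 := lt_count hI (hε j) fun h => hI.one_notMem (below_zero_iff.1 h)
    exact_mod_cast this
  have hmono : ∀ j a b, Below I a b → g j a ≤ g j b := fun j a b h =>
    div_le_div_of_nonneg_right (by exact_mod_cast count_mono hI (hε j) h) (hpos j).le
  have hg1 : ∀ j, g j 1 = 1 := fun j => div_self (hpos j).ne'
  have hg0 : ∀ j a, 0 ≤ g j a := fun j a => by positivity
  have hlim : ∀ a, ∃ L, Tendsto (fun j => g j a) (hyperfilter ℕ) (𝓝 L) := fun a => by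
    obtain ⟨L, -, hL⟩ := isCompact_Icc.ultrafilter_le_nhds
      ((hyperfilter ℕ).map fun j => g j a) (le_principal_iff.2 (Ultrafilter.mem_map.2
        (univ_mem' fun j => ⟨hg0 j a,
          (hmono j a 1 (below_of_le hI.toIsIdeal (le_one a))).trans_eq (hg1 j)⟩)))
    exact ⟨L, hL⟩
  choose φ hφ using hlim
  refine ⟨φ, fun a => ge_of_tendsto' (hφ a) fun j => hg0 j a,
    fun a b h => le_of_tendsto_of_tendsto' (hφ a) (hφ b) fun j => hmono j a b h,
    tendsto_nhds_unique (hφ 1) (by simp only [hg1]; exact tendsto_const_nhds),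
    fun a b h => le_antisymm ?_ ?_⟩
  · refine le_of_tendsto_of_tendsto' (hφ _) ((hφ a).add (hφ b)) fun j => ?_
    simp only [hg]
    rw [← add_div]
    refine div_le_div_of_nonneg_right ?_ (hpos j).le
    exact_mod_cast count_oplus_le hI (hε j) a b
  · have h0 : Tendsto (fun j : ℕ => 1 / ((j : ℝ) + 1)) (hyperfilter ℕ) (𝓝 0) :=
      tendsto_one_div_add_atTop_nhds_zero_nat.mono_left
        (by rw [← Nat.cofinite_eq_atTop]; exact hyperfilter_le_cofinite)
    have h1 := (hφ (a ⊕ₘ b)).add h0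
    rw [add_zero] at h1
    refine le_of_tendsto_of_tendsto' ((hφ a).add (hφ b)) h1 fun j => ?_
    have h2 : ((j : ℝ) + 1) * (count I (ε j) a + count I (ε j) b) ≤
        ((j : ℝ) + 1) * count I (ε j) (a ⊕ₘ b) + count I (ε j) 1 := by
      exact_mod_cast hadd j a b h
    have hj : (0 : ℝ) < (j : ℝ) + 1 := by positivity
    simp only [hg]
    rw [← add_div, div_add_div _ _ (hpos j).ne' hj.ne', div_le_div_iff₀ (hpos j)
      (mul_pos (hpos j) hj)]
    nlinarith [hpos j]

theorem IsUnitHom.map_nmul_of_eq_zero {φ : M → ℝ} (hφ : IsUnitHom φ) {a : M} (h : φ a = 0)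
    (n : ℕ) : φ (nmul n a) = 0 := by
  induction n with
  | zero => exact hφ.map_zero
  | succ n ih => rw [nmul, hφ.map_oplus, ih, h]; norm_num

theorem IsArchimedeanIdeal.exists_isUnitHom (hI : IsArchimedeanIdeal I) :
    ∃ φ : M → ℝ, IsUnitHom φ ∧ ∀ b ∉ I, 0 < φ b := by
  obtain ⟨φ, h0, hmono, h1, hadd⟩ := exists_additive hI
  have hcompl : ∀ a, φ (compl a) = 1 - φ a := fun a => by
    have h := hadd a (compl a) (below_of_le hI.toIsIdeal (by rw [compl_compl]))
    rw [oplus_compl, h1] at h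
    linarith
  have hle : ∀ a, φ a ≤ 1 := fun a =>
    (hmono _ _ (below_of_le hI.toIsIdeal (le_one a))).trans_eq h1
  have hφ : IsUnitHom φ := ⟨h0, by rw [← compl_one, hcompl, h1, sub_self], hcompl, fun a b => by
    by_cases h : Below I a (compl b)
    · rw [hadd a b h, min_eq_right]
      rw [← hadd a b h]; exact hle _
    -- Here `b*` is below `a` modulo `I`, so `a ⊕ b` is the top class.
    · have h2 := hI.below_of_not h
      have h3 := hmono _ _ h2
      rw [hcompl] at h3
      rw [min_eq_left (by linarith)]
      refine le_antisymm (hle _) (h1.symm.le.trans (hmono _ _ ?_))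
      rwa [oplus_comm, ← ominus_below_iff, one_ominus]⟩
  refine ⟨φ, hφ, fun b hb => (h0 b).lt_of_ne fun hz => ?_⟩
  obtain ⟨n, hn⟩ := hI.exists_nmul b hb
  have h2 := hmono _ _ hn
  rw [hφ.map_nmul_of_eq_zero hz.symm, h1] at h2
  exact absurd h2 (by norm_num)

end Below

/-- The homomorphisms into the unit interval separate the points of a `σ`-MV-algebra. -/
theorem exists_isUnitHom_pos {M : Type*} [SigmaMVAlgebra M] {b : M} (hb : b ≠ 0) :
    ∃ φ : M → ℝ, IsUnitHom φ ∧ 0 < φ b := by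
  obtain ⟨n, hn⟩ := exists_not_nmul_le hb
  obtain ⟨I, hI, hp, h1, hbI, harch⟩ := exists_maximal_ideal hn
  obtain ⟨φ, hφ, hpos⟩ := IsArchimedeanIdeal.exists_isUnitHom ⟨hI, hp, h1, harch⟩
  exact ⟨φ, hφ, hpos b hbI⟩

namespace IsUnitHom

variable {M : Type*} [MVAlgebra M] {φ : M → ℝ}

theorem le_one (hφ : IsUnitHom φ) (a : M) : φ a ≤ 1 := by
  rw [← oplus_zero a, hφ.map_oplus]; exact min_le_left _ _

theorem map_one (hφ : IsUnitHom φ) : φ 1 = 1 := by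
  rw [← compl_zero, hφ.map_compl, hφ.map_zero, sub_zero]

theorem mono (hφ : IsUnitHom φ) {a b : M} (h : a ≤ b) : φ a ≤ φ b := by
  obtain ⟨c, rfl⟩ := (le_iff_exists_oplus _ _).1 h
  rw [hφ.map_oplus]
  exact le_min (hφ.le_one a) (le_add_of_nonneg_right (hφ.nonneg c))

theorem map_ominus (hφ : IsUnitHom φ) (a b : M) : φ (a ⊖ₘ b) = max 0 (φ a - φ b) := by
  rw [ominus, hφ.map_compl, hφ.map_oplus, hφ.map_compl]
  rcases le_total (φ a) (φ b) with h | h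
  · rw [min_eq_left (by linarith), max_eq_left (by linarith)]; ring
  · rw [min_eq_right (by linarith), max_eq_right (by linarith)]; ring

theorem map_ominus_ominus_self (hφ : IsUnitHom φ) (a b : M) :
    φ (a ⊖ₘ (a ⊖ₘ b)) = min (φ a) (φ b) := by
  rw [hφ.map_ominus, hφ.map_ominus]
  have ha := hφ.nonneg a
  have hb := hφ.nonneg b
  rcases le_total (φ a) (φ b) with h | h
  · rw [min_eq_left h, max_eq_left (by linarith : φ a - φ b ≤ 0), sub_zero, max_eq_right ha]
  · rw [min_eq_right h, max_eq_right (by linarith : 0 ≤ φ a - φ b), sub_sub_cancel,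
      max_eq_right hb]

theorem map_nmul (hφ : IsUnitHom φ) (n : ℕ) (a : M) : φ (nmul n a) = min 1 (n * φ a) := by
  induction n with
  | zero => simp [nmul, hφ.map_zero]
  | succ n ih =>
    have ha := hφ.nonneg a
    rw [nmul, hφ.map_oplus, ih, Nat.cast_succ, add_mul, one_mul]
    rcases le_total 1 (n * φ a) with h | h
    · rw [min_eq_left h, min_eq_left (by linarith), min_eq_left (by linarith)]
    · rw [min_eq_right h]

end IsUnitHom

/-! ### The compact space of unit homomorphisms -/

/-- A term interpreted in the real unit interval as `t ↦ q t - p`, truncated to `[0, 1]`. -/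
def truncLinear {M : Type*} [MVAlgebra M] : ℕ → ℤ → M → M
  | 0, p, _ => if p < 0 then 1 else 0
  -- A Łukasiewicz product: with `u = qt - p`, it combines the truncation of `u`, increased by `t`,
  -- with the truncation of `u + 1`, yielding the truncation of `u + t`.
  | q + 1, p, a => compl (compl (truncLinear q p a ⊕ₘ a) ⊕ₘ compl (truncLinear q (p - 1) a))

theorem IsUnitHom.map_truncLinear {M : Type*} [MVAlgebra M] {φ : M → ℝ} (hφ : IsUnitHom φ)
    (a : M) (q : ℕ) : ∀ p : ℤ, φ (truncLinear q p a) = max 0 (min 1 (q * φ a - p)) := by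
  induction q with
  | zero =>
    intro p
    rw [truncLinear]
    split_ifs with h
    · have h' : (p : ℝ) ≤ -1 := by exact_mod_cast (by omega : p ≤ -1)
      rw [hφ.map_one, min_eq_left (by push_cast; linarith), max_eq_right zero_le_one]
    · have h' : (0 : ℝ) ≤ p := by exact_mod_cast not_lt.1 h
      rw [hφ.map_zero, max_eq_left]
      exact (min_le_right _ _).trans (by push_cast; linarith)
  | succ q ih =>
    intro p
    have h0 := hφ.nonneg a
    have h1 := hφ.le_one a
    rw [truncLinear, hφ.map_compl, hφ.map_oplus, hφ.map_compl, hφ.map_compl, hφ.map_oplus, ih, ih]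
    push_cast
    rw [add_mul, one_mul]
    generalize (q : ℝ) * φ a = x
    simp only [max_def, min_def]
    split_ifs <;> linarith

/-- The space of homomorphisms of `M` into the real unit interval, with the topology of
pointwise convergence. -/
abbrev UnitHom (M : Type*) [MVAlgebra M] : Type _ := {φ : M → ℝ // IsUnitHom φ}

section Space

variable {M : Type*} [MVAlgebra M]

theorem isCompact_setOf_isUnitHom : IsCompact {φ : M → ℝ | IsUnitHom φ} := by
  have hsub : {φ : M → ℝ | IsUnitHom φ} ⊆ Set.univ.pi fun _ => Set.Icc (0 : ℝ) 1 :=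
    fun φ hφ a _ => ⟨hφ.nonneg a, hφ.le_one a⟩
  refine (isCompact_univ_pi fun _ => isCompact_Icc).of_isClosed_subset ?_ hsub
  have heq : {φ : M → ℝ | IsUnitHom φ} =
      (⋂ a, {φ | 0 ≤ φ a}) ∩ {φ | φ 0 = 0} ∩ (⋂ a, {φ | φ (compl a) = 1 - φ a}) ∩
        ⋂ a, ⋂ b, {φ | φ (a ⊕ₘ b) = min 1 (φ a + φ b)} := by
    ext φ
    simp only [Set.mem_ofPred_eq, Set.mem_inter_iff, Set.mem_iInter]
    exact ⟨fun h => ⟨⟨⟨h.1, h.2⟩, h.3⟩, h.4⟩, fun h => ⟨h.1.1.1, h.1.1.2, h.1.2, h.2⟩⟩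
  rw [heq]
  refine (((isClosed_iInter fun a => ?_).inter ?_).inter (isClosed_iInter fun a => ?_)).inter
    (isClosed_iInter fun a => isClosed_iInter fun b => ?_)
  · exact isClosed_le continuous_const (continuous_apply a)
  · exact isClosed_eq (continuous_apply _) continuous_const
  · exact isClosed_eq (continuous_apply _) (continuous_const.sub (continuous_apply a))
  · exact isClosed_eq (continuous_apply _)
      (continuous_const.min ((continuous_apply a).add (continuous_apply b)))

instance : CompactSpace (UnitHom M) := isCompact_iff_compactSpace.1 isCompact_setOf_isUnitHom

theorem continuous_eval (a : M) : Continuous fun φ : UnitHom M => φ.1 a :=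
  (continuous_apply a).comp continuous_subtype_val

theorem exists_support_eval {φ₀ : M → ℝ} (h₀ : IsUnitHom φ₀) (a : M) {u : Set ℝ}
    (hu : IsOpen u) (ha : φ₀ a ∈ u) :
    ∃ c : M, 0 < φ₀ c ∧ ∀ φ : M → ℝ, IsUnitHom φ → 0 < φ c → φ a ∈ u := by
  obtain ⟨ε, hε, hball⟩ := Metric.isOpen_iff.1 hu _ ha
  obtain ⟨q, hq⟩ := exists_nat_gt (2 / ε)
  have hq0 : (0 : ℝ) < q := (by positivity : 0 < 2 / ε).trans hq
  rw [div_lt_iff₀ hε] at hq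
  -- The element below is a bump, positive exactly when `(r - 1)/q < φ a < (r + 1)/q`. This interval
  -- contains `φ₀ a` and has length `2/q < ε`.
  set r := ⌊q * φ₀ a⌋ with hr
  have hr1 : (r : ℝ) ≤ q * φ₀ a := Int.floor_le _
  have hr2 : q * φ₀ a < r + 1 := Int.lt_floor_add_one _
  have hval : ∀ φ : M → ℝ, IsUnitHom φ →
      (0 < φ (truncLinear q (r - 1) a ⊖ₘ
        (truncLinear q (r - 1) a ⊖ₘ compl (truncLinear q r a))) ↔
        (r : ℝ) - 1 < q * φ a ∧ q * φ a < r + 1) := by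
    intro φ hφ
    rw [hφ.map_ominus_ominus_self, hφ.map_compl, hφ.map_truncLinear, hφ.map_truncLinear]
    push_cast
    simp only [lt_min_iff, lt_max_iff, sub_pos, max_lt_iff, min_lt_iff, lt_self_iff_false,
      false_or, zero_lt_one, true_and]
    constructor
    · rintro ⟨h1, h2⟩; exact ⟨h1, by linarith⟩
    · rintro ⟨h1, h2⟩; exact ⟨h1, by linarith⟩
  refine ⟨_, (hval φ₀ h₀).2 ⟨by linarith, hr2⟩, fun φ hφ hpos => hball ?_⟩
  obtain ⟨h1, h2⟩ := (hval φ hφ).1 hpos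
  rw [Metric.mem_ball, Real.dist_eq]
  have : |q * (φ a - φ₀ a)| < q * ε := by
    rw [abs_lt]; constructor <;> linarith
  rw [abs_mul, abs_of_pos hq0] at this
  exact lt_of_mul_lt_mul_left this hq0.le

/-- The cozero sets of the elements of `M` form a base of the topology. -/
theorem exists_support_subset {U : Set (UnitHom M)} (hU : IsOpen U) {φ₀ : UnitHom M}
    (h₀ : φ₀ ∈ U) : ∃ c : M, 0 < φ₀.1 c ∧ ∀ φ : UnitHom M, 0 < φ.1 c → φ ∈ U := by
  classical
  obtain ⟨V, hV, rfl⟩ := isOpen_induced_iff.1 hU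
  obtain ⟨s, u, hu, hsub⟩ := isOpen_pi_iff.1 hV φ₀.1 h₀
  have key : ∀ t ⊆ s, ∃ c : M, 0 < φ₀.1 c ∧
      ∀ φ : UnitHom M, 0 < φ.1 c → ∀ i ∈ t, φ.1 i ∈ u i := by
    intro t
    induction t using Finset.induction_on with
    | empty =>
      exact fun _ => ⟨1, by rw [φ₀.2.map_one]; exact one_pos, fun _ _ i hi =>
        absurd hi (Finset.notMem_empty i)⟩
    | insert i t _ ih =>
      intro hts
      obtain ⟨c, hc, hc'⟩ := ih ((Finset.subset_insert _ _).trans hts)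
      obtain ⟨d, hd, hd'⟩ := exists_support_eval φ₀.2 i
        (hu i (hts (Finset.mem_insert_self _ _))).1 (hu i (hts (Finset.mem_insert_self _ _))).2
      refine ⟨c ⊖ₘ (c ⊖ₘ d), ?_, fun φ hφ j hj => ?_⟩
      · rw [φ₀.2.map_ominus_ominus_self]; exact lt_min hc hd
      · rw [φ.2.map_ominus_ominus_self, lt_min_iff] at hφ
        rcases Finset.mem_insert.1 hj with rfl | hj
        · exact hd' φ.1 φ.2 hφ.2
        · exact hc' φ hφ.1 j hj
  obtain ⟨c, hc, hc'⟩ := key s subset_rfl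
  exact ⟨c, hc, fun φ hφ => hsub fun i hi => hc' φ hφ i hi⟩

/-- For fixed `m`, the difference of `c` and `k d_m` is below every `d_n`, hence zero. This removes
one copy at a time. -/
theorem eq_zero_of_le_nmul_of_isGLB {d : ℕ → M} (hd : Antitone d)
    (h0 : IsGLB (Set.range d) 0) (k : ℕ) :
    ∀ {c : M}, (∀ n, c ≤ nmul k (d n)) → c = 0 := by
  induction k with
  | zero => exact fun h => le_zero_iff.1 (h 0)
  | succ k ih =>
    intro c h
    refine ih fun m => ?_
    rw [← ominus_eq_zero_iff, ← le_zero_iff]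
    refine h0.2 ?_
    rintro _ ⟨n, rfl⟩
    rw [ominus_le_iff]
    exact (h (max m n)).trans (oplus_le_oplus
      (nmul_le_nmul_right k (hd (le_max_left m n))) (hd (le_max_right m n)))

end Space

/-! ### Suprema as pointwise limits off a meagre set -/

section Sigma

open Filter Topology

variable {M : Type*} [SigmaMVAlgebra M]

theorem le_of_forall_unitHom {a b : M} (h : ∀ φ : UnitHom M, φ.1 a ≤ φ.1 b) : a ≤ b := by
  rw [← ominus_eq_zero_iff]
  by_contra hne
  obtain ⟨φ, hφ, hpos⟩ := exists_isUnitHom_pos hne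
  rw [hφ.map_ominus, max_eq_left (sub_nonpos.2 (h ⟨φ, hφ⟩))] at hpos
  exact lt_irrefl _ hpos

theorem eq_of_forall_unitHom {a b : M} (h : ∀ φ : UnitHom M, φ.1 a = φ.1 b) : a = b :=
  le_antisymm (le_of_forall_unitHom fun φ => (h φ).le) (le_of_forall_unitHom fun φ => (h φ).ge)

/-- Residual sets are dense by Baire's theorem, so a closed condition that holds on one holds
everywhere. -/
theorem forall_of_residual {P : UnitHom M → Prop} (hc : IsClosed {φ | P φ})
    (h : ∀ᶠ φ in residual (UnitHom M), P φ) (φ : UnitHom M) : P φ := by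
  have hd : Dense {φ | P φ} := dense_of_mem_residual h
  have := hd.closure_eq ▸ hc.closure_eq
  exact (this ▸ Set.mem_univ φ : φ ∈ {φ | P φ})

theorem residual_tendsto_zero {d : ℕ → M} (hd : Antitone d) (h0 : IsGLB (Set.range d) 0) :
    ∀ᶠ φ in residual (UnitHom M), Tendsto (fun n => φ.1 (d n)) atTop (𝓝 0) := by
  have key : ∀ k : ℕ, ∀ᶠ φ in residual (UnitHom M), ∃ n, φ.1 (d n) < 1 / ((k : ℝ) + 1) := by
    intro k
    have hopen : IsOpen {φ : UnitHom M | ∃ n, φ.1 (d n) < 1 / ((k : ℝ) + 1)} := by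
      simp only [Set.ofPred_exists]
      exact isOpen_iUnion fun n => isOpen_lt (continuous_eval _) continuous_const
    refine residual_of_dense_open hopen ?_
    rw [← _root_.compl_compl {φ : UnitHom M | ∃ n, φ.1 (d n) < 1 / ((k : ℝ) + 1)},
      ← interior_eq_empty_iff_dense_compl, Set.eq_empty_iff_forall_notMem]
    intro φ₀ hφ₀
    -- A cozero set inside the bad set gives an element `c ≤ (k + 1) d_n` for all `n`; such a `c` is
    -- zero.
    obtain ⟨c, hc, hsupp⟩ := exists_support_subset isOpen_interior hφ₀
    have hc0 : c = 0 := by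
      refine eq_zero_of_le_nmul_of_isGLB hd h0 (k + 1) fun n => le_of_forall_unitHom fun φ => ?_
      rcases (φ.2.nonneg c).eq_or_lt with h | h
      · rw [← h]; exact φ.2.nonneg _
      · have h1 := interior_subset (hsupp φ h)
        simp only [Set.mem_compl_iff, Set.mem_ofPred_eq, not_exists, not_lt] at h1
        have h2 := h1 n
        rw [div_le_iff₀ (by positivity)] at h2
        rw [φ.2.map_nmul, min_eq_left (by push_cast; linarith)]
        exact φ.2.le_one c
    rw [hc0, φ₀.2.map_zero] at hc
    exact lt_irrefl _ hc
  filter_upwards [eventually_countable_forall.2 key] with φ hφ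
  rw [Metric.tendsto_atTop]
  intro ε hε
  obtain ⟨k, hk⟩ := exists_nat_one_div_lt hε
  obtain ⟨n, hn⟩ := hφ k
  refine ⟨n, fun m hm => ?_⟩
  rw [Real.dist_0_eq_abs, abs_of_nonneg (φ.2.nonneg _)]
  exact ((φ.2.mono (hd hm)).trans_lt hn).trans hk

/-- The differences `s ⊖ a n` decrease to 0: a common lower bound `b` makes `s ⊖ b` an upper bound
of the sequence, so `b = 0`. -/
theorem residual_tendsto_of_isLUB {a : ℕ → M} (ha : Monotone a) {s : M}
    (hs : IsLUB (Set.range a) s) :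
    ∀ᶠ φ in residual (UnitHom M), Tendsto (fun n => φ.1 (a n)) atTop (𝓝 (φ.1 s)) := by
  have hle : ∀ n, a n ≤ s := fun n => hs.1 ⟨n, rfl⟩
  have hval : ∀ (φ : UnitHom M) n, φ.1 (s ⊖ₘ a n) = φ.1 s - φ.1 (a n) := fun φ n => by
    rw [φ.2.map_ominus, max_eq_right (sub_nonneg.2 (φ.2.mono (hle n)))]
  have hd : Antitone fun n => s ⊖ₘ a n := fun m n h => le_of_forall_unitHom fun φ => by
    rw [hval, hval]; exact sub_le_sub_left (φ.2.mono (ha h)) _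
  have h0 : IsGLB (Set.range fun n => s ⊖ₘ a n) 0 := by
    refine ⟨by rintro _ ⟨n, rfl⟩; exact zero_le _, fun b hb => ?_⟩
    have hb' : ∀ n (φ : UnitHom M), φ.1 b ≤ φ.1 s - φ.1 (a n) := fun n φ => by
      rw [← hval]; exact φ.2.mono (hb ⟨n, rfl⟩)
    have h1 : s ≤ s ⊖ₘ b := hs.2 (by
      rintro _ ⟨n, rfl⟩
      refine le_of_forall_unitHom fun φ => ?_
      rw [φ.2.map_ominus]
      exact le_max_of_le_right (by linarith [hb' n φ]))
    refine le_of_forall_unitHom fun φ => ?_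
    have h2 := φ.2.mono h1
    rw [φ.2.map_ominus, max_eq_right (by linarith [hb' 0 φ, φ.2.nonneg (a 0)])] at h2
    rw [φ.2.map_zero]
    linarith
  filter_upwards [residual_tendsto_zero hd h0] with φ hφ
  have h1 := hφ.const_sub (φ.1 s)
  simpa only [hval, sub_sub_cancel, sub_zero] using h1

end Sigma

end MVAlgebra

/-! ### Stieltjes measures and existence of the observable -/

open MVAlgebra MeasureTheory Filter Topology

/-- An induction principle for the Borel sets of the real line. -/
theorem borel_real_induction {C : Set ℝ → Prop} (empty : C ∅) (Iio : ∀ t, C (Set.Iio t))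
    (compl : ∀ E, MeasurableSet E → C E → C Eᶜ)
    (union : ∀ E F, MeasurableSet E → MeasurableSet F → Disjoint E F → C E → C F → C (E ∪ F))
    (iUnion : ∀ E : ℕ → Set ℝ, (∀ i, MeasurableSet (E i)) → Monotone E → (∀ i, C (E i)) →
      C (⋃ i, E i)) (E : Set ℝ) (hE : MeasurableSet E) : C E := by
  refine MeasurableSpace.induction_on_inter (C := fun s _ => C s)
    (BorelSpace.measurable_eq.trans (borel_eq_generateFrom_Iio ℝ)) isPiSystem_Iio empty
    ?_ compl ?_ E hE
  · rintro _ ⟨t, rfl⟩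
    exact Iio t
  · intro F hd hF hC
    -- A countable disjoint union is the increasing union of its finite partial unions, matching the
    -- two closure hypotheses.
    have hmeas : ∀ n, MeasurableSet (partialSups F n) := fun n => by
      induction n with
      | zero => rw [partialSups_zero]; exact hF 0
      | succ n ih => rw [partialSups_add_one]; exact ih.union (hF _)
    have hP : ∀ n, C (partialSups F n) := fun n => by
      induction n with
      | zero => rw [partialSups_zero]; exact hC 0
      | succ n ih =>
        rw [partialSups_add_one]
        refine union _ _ (hmeas n) (hF _) ?_ ih (hC _)
        rw [disjoint_partialSups_left]
        exact fun k hk => hd (by omega)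
    have heq : ⋃ n, partialSups F n = ⋃ n, F n := iSup_partialSups_eq F
    rw [← heq]
    exact iUnion _ hmeas (partialSups F).monotone hP

section Measure

variable {M : Type*} [SigmaMVAlgebra M] {f : ℝ → M}

theorem IsDistributionFamily.monotone (hf : IsDistributionFamily f) : Monotone f := fun t s h =>
  h.eq_or_lt.elim (fun h => h ▸ le_rfl) (hf.mono t s)

theorem monotone_eval_comp (hf : Monotone f) (φ : UnitHom M) : Monotone fun t => φ.1 (f t) :=
  fun _ _ h => φ.2.mono (hf h)

/-- The measure on the real line with distribution function `t ↦ φ (f t)`. -/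
noncomputable def distMeasure (hf : Monotone f) (φ : UnitHom M) : Measure ℝ :=
  (monotone_eval_comp hf φ).stieltjesFunction.measure

theorem IsDistributionFamily.residual_tendsto_atTop (hf : IsDistributionFamily f) :
    ∀ᶠ φ in residual (UnitHom M), Tendsto (fun t => φ.1 (f t)) atTop (𝓝 1) := by
  have hmono : Monotone fun n : ℕ => f n := fun m n h => hf.monotone (Nat.cast_le.2 h)
  have hlub : IsLUB (Set.range fun n : ℕ => f n) 1 := by
    refine ⟨by rintro _ ⟨n, rfl⟩; exact le_one _, fun c hc => hf.isLUB_one.2 ?_⟩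
    rintro _ ⟨t, rfl⟩
    obtain ⟨n, hn⟩ := exists_nat_ge t
    exact (hf.monotone hn).trans (hc ⟨n, rfl⟩)
  filter_upwards [residual_tendsto_of_isLUB hmono hlub] with φ hφ
  rw [φ.2.map_one] at hφ
  exact (tendsto_iff_tendsto_subseq_of_monotone (monotone_eval_comp hf.monotone φ)
    tendsto_natCast_atTop_atTop).2 hφ

theorem IsDistributionFamily.residual_tendsto_atBot (hf : IsDistributionFamily f) :
    ∀ᶠ φ in residual (UnitHom M), Tendsto (fun t => φ.1 (f t)) atBot (𝓝 0) := by
  have hanti : Antitone fun n : ℕ => f (-n) := fun m n h =>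
    hf.monotone (neg_le_neg (Nat.cast_le.2 h))
  have hglb : IsGLB (Set.range fun n : ℕ => f (-n)) 0 := by
    refine ⟨by rintro _ ⟨n, rfl⟩; exact zero_le _, fun c hc => hf.isGLB_zero.2 ?_⟩
    rintro _ ⟨t, rfl⟩
    obtain ⟨n, hn⟩ := exists_nat_ge (-t)
    exact (hc ⟨n, rfl⟩).trans (hf.monotone (by linarith))
  filter_upwards [residual_tendsto_zero hanti hglb] with φ hφ
  have h1 : Tendsto (fun t => φ.1 (f (-t))) atTop (𝓝 0) :=
    (tendsto_iff_tendsto_subseq_of_antitone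
      (fun _ _ h => monotone_eval_comp hf.monotone φ (neg_le_neg h))
      tendsto_natCast_atTop_atTop).2 hφ
  simpa only [Function.comp_def, neg_neg] using h1.comp tendsto_neg_atBot_atTop

theorem IsDistributionFamily.residual_isProbabilityMeasure (hf : IsDistributionFamily f) :
    ∀ᶠ φ in residual (UnitHom M), IsProbabilityMeasure (distMeasure hf.monotone φ) := by
  filter_upwards [hf.residual_tendsto_atTop, hf.residual_tendsto_atBot] with φ h1 h0
  exact StieltjesFunction.isProbabilityMeasure _ (tendsto_rightLim_atBot_of_tendsto h0)
    (tendsto_rightLim_atTop_of_tendsto h1)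

theorem IsDistributionFamily.residual_leftLim_eq (hf : IsDistributionFamily f) (t : ℝ) :
    ∀ᶠ φ in residual (UnitHom M), Function.leftLim (fun t => φ.1 (f t)) t = φ.1 (f t) := by
  have hu : Antitone fun n : ℕ => 1 / ((n : ℝ) + 1) := fun m n h =>
    one_div_le_one_div_of_le (by positivity) (by gcongr)
  have hmono : Monotone fun n : ℕ => f (t - 1 / ((n : ℝ) + 1)) := fun m n h =>
    hf.monotone (sub_le_sub_left (hu h) t)
  have hlt : ∀ n : ℕ, t - 1 / ((n : ℝ) + 1) < t := fun n => sub_lt_self _ (by positivity)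
  have hlub : IsLUB (Set.range fun n : ℕ => f (t - 1 / ((n : ℝ) + 1))) (f t) := by
    refine ⟨by rintro _ ⟨n, rfl⟩; exact hf.monotone (hlt n).le,
      fun c hc => (hf.left_cont t).2 ?_⟩
    rintro _ ⟨s, hs, rfl⟩
    obtain ⟨n, hn⟩ := exists_nat_one_div_lt (sub_pos.2 (show s < t from hs))
    exact (hf.monotone (by linarith)).trans (hc ⟨n, rfl⟩)
  have htend : Tendsto (fun n : ℕ => t - 1 / ((n : ℝ) + 1)) atTop (𝓝[<] t) := by
    refine tendsto_nhdsWithin_iff.2 ⟨?_, Eventually.of_forall hlt⟩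
    simpa only [sub_zero] using tendsto_one_div_add_atTop_nhds_zero_nat.const_sub t
  filter_upwards [residual_tendsto_of_isLUB hmono hlub] with φ hφ
  exact tendsto_nhds_unique
    (((monotone_eval_comp hf.monotone φ).tendsto_leftLim t).comp htend) hφ

/-- The Stieltjes function is the right-limit regularisation, which keeps left limits; the measure
of `(-∞, t)` is therefore a left limit of `φ ∘ f`. The exceptional meagre set may depend on `t`. -/
theorem IsDistributionFamily.residual_measureReal_Iio (hf : IsDistributionFamily f) (t : ℝ) :
    ∀ᶠ φ in residual (UnitHom M), (distMeasure hf.monotone φ).real (Set.Iio t) = φ.1 (f t) := by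
  filter_upwards [hf.residual_tendsto_atBot, hf.residual_leftLim_eq t] with φ h0 ht
  have hleft : Function.leftLim (monotone_eval_comp hf.monotone φ).stieltjesFunction t =
      φ.1 (f t) :=
    (leftLim_rightLim ((monotone_eval_comp hf.monotone φ).tendsto_leftLim t)).trans ht
  rw [measureReal_def, distMeasure,
    StieltjesFunction.measure_Iio _ (tendsto_rightLim_atBot_of_tendsto h0), hleft, sub_zero,
    ENNReal.toReal_ofReal (φ.2.nonneg _)]

theorem tendsto_measureReal_iUnion {μ : Measure ℝ} [IsProbabilityMeasure μ] {E : ℕ → Set ℝ}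
    (hE : Monotone E) : Tendsto (fun n => μ.real (E n)) atTop (𝓝 (μ.real (⋃ i, E i))) :=
  (ENNReal.tendsto_toReal (measure_ne_top μ _)).comp (tendsto_measure_iUnion_atTop hE)

/-- Each Borel set has a value in `M` that represents its measures. -/
theorem IsDistributionFamily.exists_value (hf : IsDistributionFamily f) {E : Set ℝ}
    (hE : MeasurableSet E) :
    ∃ a : M, ∀ᶠ φ in residual (UnitHom M), (distMeasure hf.monotone φ).real E = φ.1 a := by
  refine borel_real_induction (C := fun E => ∃ a : M, ∀ᶠ φ in residual (UnitHom M),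
    (distMeasure hf.monotone φ).real E = φ.1 a) ?_ (fun t => ⟨f t, hf.residual_measureReal_Iio t⟩)
    ?_ ?_ ?_ E hE
  · exact ⟨0, Eventually.of_forall fun φ => by rw [measureReal_empty, φ.2.map_zero]⟩
  · rintro E hE ⟨a, ha⟩
    refine ⟨compl a, ?_⟩
    filter_upwards [ha, hf.residual_isProbabilityMeasure] with φ h hp
    rw [probReal_compl_eq_one_sub hE, h, φ.2.map_compl]
  · rintro E F hE hF hd ⟨a, ha⟩ ⟨b, hb⟩
    refine ⟨oplus a b, ?_⟩
    filter_upwards [ha, hb, hf.residual_isProbabilityMeasure] with φ h h' hp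
    have hu := measureReal_union (μ := distMeasure hf.monotone φ) hd hF
    have hle := measureReal_le_one (μ := distMeasure hf.monotone φ) (s := E ∪ F)
    rw [φ.2.map_oplus, ← h, ← h', ← hu, min_eq_right hle]
  · intro E _ hmono hC
    choose a ha using hC
    have hall := eventually_countable_forall.2 ha
    -- The order among the values comes from that of the measures, by density; only then can their
    -- supremum in `M` be matched with continuity of the measures.
    have hamono : Monotone a := fun m n hmn => le_of_forall_unitHom fun φ => by
      refine forall_of_residual (isClosed_le (continuous_eval (a m)) (continuous_eval (a n))) ?_ φ
      filter_upwards [hall, hf.residual_isProbabilityMeasure] with φ h hp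
      rw [← h, ← h]
      exact measureReal_mono (hmono hmn)
    obtain ⟨s, hs⟩ := SigmaMVAlgebra.exists_isLUB a
    refine ⟨s, ?_⟩
    filter_upwards [hall, hf.residual_isProbabilityMeasure, residual_tendsto_of_isLUB hamono hs]
      with φ h hp hlim
    refine tendsto_nhds_unique (tendsto_measureReal_iUnion hmono) ?_
    simpa only [h] using hlim

/-- A family with the properties of a distribution comes from an observable. -/
theorem IsDistributionFamily.exists_isObservable (hf : IsDistributionFamily f) :
    ∃ x : BorelSet → M, IsObservable x ∧ ∀ t : ℝ, x (BorelSet.Iio t) = f t := by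
  choose x hx using fun E : BorelSet => hf.exists_value E.2
  -- Relations between values of `x` need checking only for residually many `φ`, where they become
  -- properties of a probability measure.
  have huniq : ∀ a b : M, (∀ᶠ φ in residual (UnitHom M), φ.1 a = φ.1 b) → a = b := fun a b h =>
    eq_of_forall_unitHom
      (forall_of_residual (isClosed_eq (continuous_eval a) (continuous_eval b)) h)
  have hle : ∀ a b : M, (∀ᶠ φ in residual (UnitHom M), φ.1 a ≤ φ.1 b) → a ≤ b := fun a b h =>
    le_of_forall_unitHom
      (forall_of_residual (isClosed_le (continuous_eval a) (continuous_eval b)) h)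
  refine ⟨x, ⟨huniq _ _ ?_, fun E F hE hF hd => ⟨hle _ _ ?_, huniq _ _ ?_⟩,
    fun E hE hsub => ⟨?_, fun c hc => hle _ _ ?_⟩⟩, fun t => huniq _ _ ?_⟩
  · filter_upwards [hx ⟨Set.univ, .univ⟩, hf.residual_isProbabilityMeasure] with φ h hp
    rw [← h, φ.2.map_one, probReal_univ]
  · filter_upwards [hx ⟨E, hE⟩, hx ⟨F, hF⟩, hf.residual_isProbabilityMeasure] with φ h h' hp
    have hu := measureReal_union (μ := distMeasure hf.monotone φ) hd hF
    have h1 := measureReal_le_one (μ := distMeasure hf.monotone φ) (s := E ∪ F)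
    rw [φ.2.map_compl, ← h, ← h']
    linarith
  · filter_upwards [hx ⟨E, hE⟩, hx ⟨F, hF⟩, hx ⟨E ∪ F, hE.union hF⟩,
      hf.residual_isProbabilityMeasure] with φ h h' hEF hp
    have hu := measureReal_union (μ := distMeasure hf.monotone φ) hd hF
    have h1 := measureReal_le_one (μ := distMeasure hf.monotone φ) (s := E ∪ F)
    rw [φ.2.map_oplus, ← h, ← h', ← hEF, ← hu, min_eq_right h1]
  · rintro _ ⟨i, rfl⟩
    refine hle _ _ ?_
    filter_upwards [hx ⟨E i, hE i⟩, hx ⟨⋃ i, E i, .iUnion hE⟩,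
      hf.residual_isProbabilityMeasure] with φ h h' hp
    rw [← h, ← h']
    exact measureReal_mono (Set.subset_iUnion E i)
  · filter_upwards [eventually_countable_forall.2 fun i => hx ⟨E i, hE i⟩,
      hx ⟨⋃ i, E i, .iUnion hE⟩, hf.residual_isProbabilityMeasure] with φ h h' hp
    rw [← h']
    refine le_of_tendsto' (tendsto_measureReal_iUnion (monotone_nat_of_le_succ hsub)) fun i => ?_
    exact (h i).trans_le (φ.2.mono (hc ⟨i, rfl⟩))
  · filter_upwards [hx (BorelSet.Iio t), hf.residual_measureReal_Iio t] with φ h h'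
    rw [← h, ← h']
    rfl

end Measure

/-! ### Properties of observables and uniqueness -/

namespace IsObservable

variable {M : Type*} [SigmaMVAlgebra M] {x y : BorelSet → M}

theorem map_compl (hx : IsObservable x) {E : Set ℝ} (hE : MeasurableSet E) :
    x ⟨Eᶜ, hE.compl⟩ = compl (x ⟨E, hE⟩) := by
  obtain ⟨h1, h2⟩ := hx.map_union E Eᶜ hE hE.compl disjoint_compl_right
  have h3 : x ⟨E ∪ Eᶜ, hE.union hE.compl⟩ = 1 := by
    rw [← hx.map_univ]; congr 2; exact Set.union_compl_self E
  refine le_antisymm ?_ ?_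
  · rw [← MVAlgebra.compl_compl (x ⟨Eᶜ, hE.compl⟩)]
    exact compl_le_compl h1
  · exact (le_def _ _).2 (by rw [MVAlgebra.compl_compl, h2, h3])

theorem map_empty (hx : IsObservable x) : x ⟨∅, .empty⟩ = 0 := by
  have h : x ⟨∅, .empty⟩ = x ⟨Set.univᶜ, MeasurableSet.univ.compl⟩ := by
    congr 2; exact Set.compl_univ.symm
  rw [h, hx.map_compl .univ, hx.map_univ, compl_one]

theorem mono (hx : IsObservable x) {E F : Set ℝ} (hE : MeasurableSet E) (hF : MeasurableSet F)
    (h : E ⊆ F) : x ⟨E, hE⟩ ≤ x ⟨F, hF⟩ := by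
  obtain ⟨-, h2⟩ := hx.map_union E (F \ E) hE (hF.diff hE) Set.disjoint_sdiff_right
  have h3 : x ⟨E ∪ F \ E, hE.union (hF.diff hE)⟩ = x ⟨F, hF⟩ := by
    congr 2; exact Set.union_sdiff_cancel h
  rw [← h3, ← h2]
  exact le_oplus_left _ _

/-- An observable is determined by its values on the half-lines `(-∞, t)`. -/
theorem ext_Iio (hx : IsObservable x) (hy : IsObservable y)
    (h : ∀ t, x (BorelSet.Iio t) = y (BorelSet.Iio t)) : x = y := by
  have key : ∀ E : Set ℝ, MeasurableSet E → ∀ hE : MeasurableSet E, x ⟨E, hE⟩ = y ⟨E, hE⟩ := by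
    refine borel_real_induction ?_ (fun t _ => h t) ?_ ?_ ?_
    · intro _
      rw [hx.map_empty, hy.map_empty]
    · intro E hE hxy _
      rw [hx.map_compl hE, hy.map_compl hE, hxy hE]
    · intro E F hE hF hd h1 h2 _
      rw [← (hx.map_union E F hE hF hd).2, ← (hy.map_union E F hE hF hd).2, h1 hE, h2 hF]
    · intro E hE hmono hxy _
      have hsub : ∀ i, E i ⊆ E (i + 1) := fun i => hmono i.le_succ
      have h1 := hx.map_iUnion E hE hsub
      simp only [fun i => hxy i (hE i)] at h1
      exact h1.unique (hy.map_iUnion E hE hsub)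
  exact funext fun E => key E.1 E.2 E.2

/-- The values of an observable on the half-lines `(-∞, t)` have the properties of a
distribution. -/
theorem isDistributionFamily (hx : IsObservable x) :
    IsDistributionFamily fun t : ℝ => x (BorelSet.Iio t) where
  mono t s h := hx.mono _ _ (Set.Iio_subset_Iio h.le)
  isGLB_zero := by
    refine ⟨by rintro _ ⟨t, rfl⟩; exact zero_le _, fun c hc => ?_⟩
    -- Only increasing unions are available, so the infimum is treated by complements: `c*` bounds
    -- the values on `[-n, ∞)`, whose union is the line.
    have hlub := hx.map_iUnion (fun n : ℕ => (Set.Iio (-(n : ℝ)))ᶜ)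
      (fun n => measurableSet_Iio.compl) fun n =>
        Set.compl_subset_compl.2 (Set.Iio_subset_Iio (by push_cast; linarith))
    have huniv : (⋃ n : ℕ, (Set.Iio (-(n : ℝ)))ᶜ) = Set.univ := by
      refine Set.eq_univ_of_forall fun t => Set.mem_iUnion.2 ?_
      obtain ⟨n, hn⟩ := exists_nat_ge (-t)
      exact ⟨n, by rw [Set.compl_Iio, Set.mem_Ici]; linarith⟩
    have hle := hlub.2 (show compl c ∈ _ by
      rintro _ ⟨n, rfl⟩
      dsimp only
      rw [hx.map_compl measurableSet_Iio]
      exact compl_le_compl (hc ⟨-(n : ℝ), rfl⟩))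
    have h1 : (1 : M) ≤ compl c := by
      rw [← hx.map_univ]
      exact (by simpa only [huniv] using hle)
    rw [← compl_one]
    simpa only [MVAlgebra.compl_compl] using compl_le_compl h1
  isLUB_one := by
    refine ⟨by rintro _ ⟨t, rfl⟩; exact le_one _, fun c hc => ?_⟩
    have hlub := hx.map_iUnion (fun n : ℕ => Set.Iio (n : ℝ)) (fun n => measurableSet_Iio)
      fun n => Set.Iio_subset_Iio (by push_cast; linarith)
    have huniv : (⋃ n : ℕ, Set.Iio (n : ℝ)) = Set.univ := by
      refine Set.eq_univ_of_forall fun t => Set.mem_iUnion.2 (exists_nat_gt t)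
    have hle := hlub.2 (show c ∈ _ by rintro _ ⟨n, rfl⟩; exact hc ⟨(n : ℝ), rfl⟩)
    rw [← hx.map_univ]
    exact (by simpa only [huniv] using hle)
  left_cont s := by
    refine ⟨by rintro _ ⟨t, ht, rfl⟩; exact hx.mono _ _ (Set.Iio_subset_Iio (le_of_lt ht)),
      fun c hc => ?_⟩
    have hlub := hx.map_iUnion (fun n : ℕ => Set.Iio (s - 1 / ((n : ℝ) + 1)))
      (fun n => measurableSet_Iio) fun n => Set.Iio_subset_Iio (sub_le_sub_left
        (one_div_le_one_div_of_le (by positivity) (by push_cast; linarith)) s)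
    have hIio : (⋃ n : ℕ, Set.Iio (s - 1 / ((n : ℝ) + 1))) = Set.Iio s := by
      ext t
      simp only [Set.mem_iUnion, Set.mem_Iio]
      constructor
      · rintro ⟨n, hn⟩
        exact hn.trans (sub_lt_self _ (by positivity))
      · intro ht
        obtain ⟨n, hn⟩ := exists_nat_one_div_lt (sub_pos.2 ht)
        exact ⟨n, by linarith⟩
    have hle := hlub.2 (show c ∈ _ by
      rintro _ ⟨n, rfl⟩
      exact hc ⟨_, Set.mem_Iio.2 (sub_lt_self s (by positivity)), rfl⟩)
    simp only [hIio] at hle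
    exact hle

end IsObservable

theorem theorem3p2 {M : Type*} [SigmaMVAlgebra M] :
    (∀ x : BorelSet → M, IsObservable x →
      IsDistributionFamily fun t : ℝ => x (BorelSet.Iio t)) ∧
    (∀ f : ℝ → M, IsDistributionFamily f →
      ∃! x : BorelSet → M, IsObservable x ∧ ∀ t : ℝ, x (BorelSet.Iio t) = f t) := by
  refine ⟨fun x hx => hx.isDistributionFamily, fun f hf => ?_⟩
  obtain ⟨x, hx, hxf⟩ := hf.exists_isObservable
  exact ⟨x, ⟨hx, hxf⟩, fun y hy => hy.1.ext_Iio hx fun t => (hy.2 t).trans (hxf t).symm⟩
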